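/- Let $\hbar>0$ and $n\in\mathbb N$, and equip $\mathbb{R}^{2n}$ with the standard symplectic form $\sigma(z,z')=Jz\cdot z'$, $J=\begin{pmatrix}0&I\\-I&0\end{pmatrix}$. Let $(\ell,\ell')$ be a Lagrangian frame, i.e. $\ell,\ell'\subset\mathbb{R}^{2n}$ are $n$-dimensional linear subspaces on which $\sigma$ vanishes and $\ell\cap\ell'=0$. Let $X_\ell\subset\ell$ be a (nondegenerate) ellipsoid centered at $0$, let $$(X_\ell)^\hbar_{\ell'}=\{z'\in\ell' : \sup_{z\in X_\ell}\sigma(z,z')\le\hbar\}$$ be its Lagrangian polar dual, and let $P_{\ell'}\subset\ell'$ be a (nondegenerate) ellipsoid centered at $0$ with $(X_\ell)^\hbar_{\ell'}\subsetneq P_{\ell'}$. (Then $X_\ell\times P_{\ell'}$, viewed as the set $\{z+z' : z\in X_\ell,\ z'\in P_{\ell'}\}\subset\mathbb{R}^{2n}=\ell\oplus\ell'$, is called a geometric mixed quantum state.) Then the John ellipsoid $\Omega$ of $X_\ell\times P_{\ell'}$, that is, the unique ellipsoid of maximal volume (with arbitrary center) contained in $X_\ell\times P_{\ell'}$, exists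 and is quantum admissible: $\Omega=\{z\in\mathbb{R}^{2n} : Mz\cdot z\le\hbar\}$ for some symmetric positive definite matrix $M$, and there is $S\in\mathrm{Sp}(n)$ (a real $2n\times 2n$ matrix with $S^TJS=J$) such that $S(B^{2n}(\sqrt\hbar))\subset\Omega$, where $B^{2n}(\sqrt\hbar)$ is the closed Euclidean ball of radius $\sqrt\hbar$ centered at $0$. -/

import Mathlib

open scoped Matrix Pointwise

noncomputable section

namespace GeomQuantum

/-- Phase space `ℝ²ⁿ`, with points `z = (x, p)`: `Sum.inl` indexes positions `x`, `Sum.inr` momenta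
`p`. Euclidean quantities are written with the dot product `⬝ᵥ` (the sup norm that Mathlib puts on
function spaces is never used); `volume` on it is Lebesgue measure. -/
abbrev Phase (n : ℕ) : Type := Fin n ⊕ Fin n → ℝ

/-- The standard symplectic matrix `J = (0 I; -I 0)`. -/
def stdJ (n : ℕ) : Matrix (Fin n ⊕ Fin n) (Fin n ⊕ Fin n) ℝ :=
  Matrix.fromBlocks 0 1 (-1) 0

/-- The standard symplectic form `σ(z, z') = J z · z'`. -/
def sympForm {n : ℕ} (z z' : Phase n) : ℝ := (stdJ n *ᵥ z) ⬝ᵥ z'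

/-- The closed Euclidean ball `B²ⁿ(r)` of radius `r` centered at `0`. -/
def closedBall₂ (n : ℕ) (r : ℝ) : Set (Phase n) := {z | z ⬝ᵥ z ≤ r ^ 2}

/-- Lagrangian planes: `n`-dimensional linear subspaces on which `σ` vanishes. -/
structure IsLagrangian {n : ℕ} (ℓ : Submodule ℝ (Phase n)) : Prop where
  finrank_eq : Module.finrank ℝ ℓ = n
  isotropic : ∀ z ∈ ℓ, ∀ z' ∈ ℓ, sympForm z z' = 0

/-- Lagrangian frames: pairs of transversal Lagrangian planes. -/
structure IsLagrangianFrame {n : ℕ} (ℓ ℓ' : Submodule ℝ (Phase n)) : Prop where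
  left : IsLagrangian ℓ
  right : IsLagrangian ℓ'
  transversal : ℓ ⊓ ℓ' = ⊥

/-- `E` is a (nondegenerate) ellipsoid with center `0` in the linear subspace `F`, i.e. the closed
unit ball of a positive definite quadratic form on `F`. -/
def IsCenteredEllipsoidIn {n : ℕ} (F : Submodule ℝ (Phase n)) (E : Set (Phase n)) : Prop :=
  ∃ q : QuadraticForm ℝ F, q.PosDef ∧ E = (fun z : F => (z : Phase n)) '' {z : F | q z ≤ 1}

/-- The Lagrangian polar dual of `X` with respect to `ℓ'`:
all `z' ∈ ℓ'` with `sup_{z ∈ X} σ(z, z') ≤ ħ`. -/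
def lagrangianPolarDual {n : ℕ} (ħ : ℝ) (ℓ' : Submodule ℝ (Phase n)) (X : Set (Phase n)) :
    Set (Phase n) :=
  {z' | z' ∈ ℓ' ∧ ∀ z ∈ X, sympForm z z' ≤ ħ}

/-- The data of a geometric mixed quantum state. -/
structure IsGeometricMixedState {n : ℕ} (ħ : ℝ) (ℓ ℓ' : Submodule ℝ (Phase n))
    (X P : Set (Phase n)) : Prop where
  frame : IsLagrangianFrame ℓ ℓ'
  ellipsoid_left : IsCenteredEllipsoidIn ℓ X
  ellipsoid_right : IsCenteredEllipsoidIn ℓ' P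
  polarDual_subset : lagrangianPolarDual ħ ℓ' X ⊆ P
  ne_polarDual : P ≠ lagrangianPolarDual ħ ℓ' X

/-- The product `X × P` of `X ⊆ ℓ` and `P ⊆ ℓ'`, regarded as a subset of `ℝ²ⁿ` through the
identification `ℓ ⊕ ℓ' = ℝ²ⁿ`, `(z, z') ↦ z + z'`. -/
def frameProduct {n : ℕ} (X P : Set (Phase n)) : Set (Phase n) := X + P

/-- Nondegenerate solid ellipsoids in `ℝ²ⁿ` with arbitrary center. -/
def IsEllipsoid {n : ℕ} (E : Set (Phase n)) : Prop :=
  ∃ (c : Phase n) (M : Matrix (Fin n ⊕ Fin n) (Fin n ⊕ Fin n) ℝ),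
    M.PosDef ∧ E = {z | (M *ᵥ (z - c)) ⬝ᵥ (z - c) ≤ 1}

/-- `E` is an ellipsoid of maximal volume among all ellipsoids contained in `K`. -/
structure IsJohnEllipsoid {n : ℕ} (K E : Set (Phase n)) : Prop where
  isEllipsoid : IsEllipsoid E
  subset : E ⊆ K
  volume_le : ∀ E' : Set (Phase n), IsEllipsoid E' → E' ⊆ K →
    MeasureTheory.volume E' ≤ MeasureTheory.volume E

/-- The quantum blob `S(B²ⁿ(√ħ))`. -/
def quantumBlob {n : ℕ} (ħ : ℝ) (S : Matrix (Fin n ⊕ Fin n) (Fin n ⊕ Fin n) ℝ) :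
    Set (Phase n) :=
  (fun z : Phase n => S *ᵥ z) '' closedBall₂ n (√ħ)

/-- `Ω` is an ellipsoid `{z : M z · z ≤ ħ}` with `M` symmetric positive definite, and it contains a
quantum blob `S(B²ⁿ(√ħ))` with `S` symplectic. (Mathlib's symplectic group is defined through `-J`,
which gives the same group.) -/
def IsQuantumAdmissible {n : ℕ} (ħ : ℝ) (Ω : Set (Phase n)) : Prop :=
  (∃ M : Matrix (Fin n ⊕ Fin n) (Fin n ⊕ Fin n) ℝ,
    M.PosDef ∧ Ω = {z | (M *ᵥ z) ⬝ᵥ z ≤ ħ}) ∧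
  ∃ S ∈ Matrix.symplecticGroup (Fin n) ℝ, quantumBlob ħ S ⊆ Ω

end GeomQuantum

end

namespace GeomQuantum

open Matrix MeasureTheory

/-! Linear coordinates on `ℓ` and `ℓ'` in which `X` and `P` are Euclidean unit balls give a linear
isomorphism `T` of phase space carrying `Bⁿ × Bⁿ` onto `X + P`. John ellipsoids are equivariant
under `T`, and `Bⁿ × Bⁿ` lies between the unit ball and the cube `[-1,1]²ⁿ`, in which the unit ball
is the unique ellipsoid of largest volume (`eq_closedBall₂_of_subset_cube`). Hence the John
ellipsoid is exactly `T(B²ⁿ(1))`.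

In these coordinates `σ` becomes an off-diagonal pairing `x · G y`, and the polar dual inclusion
says `|G y| ≥ ħ |y|`: all singular values of `G` are at least `ħ`. A singular value decomposition,
with each singular value split evenly between the two factors, yields `R₁`, `R₂` of norm at most
`1/√ħ` with `R₁ᵀ G R₂ = 1`. Then `T ∘ diag(-R₁, R₂)` is symplectic and maps `B²ⁿ(√ħ)` into
`T(B²ⁿ(1))`. -/

/-! ### Ellipsoids, and the maximality of the ball in the cube -/

/-- Arithmetic–geometric mean rigidity: a positive definite matrix with diagonal entries at most `1`
and determinant at least `1` is the identity. -/
lemma posDef_eq_one_of_diag_le_one {ι : Type*} [Fintype ι] [DecidableEq ι] {W : Matrix ι ι ℝ}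
    (hW : W.PosDef) (hdiag : ∀ i, W i i ≤ 1) (hdet : 1 ≤ W.det) : W = 1 := by
  have hH := hW.isHermitian
  have hpos := hW.eigenvalues_pos
  have htr : ∑ i, hH.eigenvalues i ≤ ∑ _i : ι, (1 : ℝ) := by
    have h := hH.trace_eq_sum_eigenvalues
    simp only [RCLike.ofReal_real_eq_id, id] at h
    rw [← h]
    exact Finset.sum_le_sum fun i _ => hdiag i
  have hlog : 0 ≤ ∑ i, Real.log (hH.eigenvalues i) := by
    rw [← Real.log_prod fun i _ => (hpos i).ne']
    have h := hH.det_eq_prod_eigenvalues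
    simp only [RCLike.ofReal_real_eq_id, id] at h
    rw [← h]
    exact Real.log_nonneg hdet
  -- Each term is nonnegative by `log t ≤ t - 1`, while the trace and determinant bounds make their
  -- sum nonpositive. So every term vanishes, and equality holds only at `t = 1`.
  have hterm : ∀ i, 0 ≤ hH.eigenvalues i - 1 - Real.log (hH.eigenvalues i) := fun i => by
    linarith [Real.log_le_sub_one_of_pos (hpos i)]
  have hsum : ∑ i, (hH.eigenvalues i - 1 - Real.log (hH.eigenvalues i)) = 0 := by
    refine le_antisymm ?_ (Finset.sum_nonneg fun i _ => hterm i)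
    simp only [Finset.sum_sub_distrib]
    linarith
  have hone : hH.eigenvalues = fun _ => 1 := by
    funext i
    by_contra hne
    have h0 := (Finset.sum_eq_zero_iff_of_nonneg fun i _ => hterm i).1 hsum i (Finset.mem_univ i)
    linarith [Real.log_lt_sub_one_of_pos (hpos i) hne]
  rw [hH.spectral_theorem, hone]
  have : (diagonal (RCLike.ofReal ∘ fun _ : ι => (1 : ℝ)) : Matrix ι ι ℝ) = 1 := by
    ext i j; simp [Matrix.one_apply, diagonal_apply]
  rw [this, map_one]

lemma mulVec_dotProduct_mulVec {ι κ : Type*} [Fintype ι] [Fintype κ] (B : Matrix ι κ ℝ)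
    (x y : κ → ℝ) : (B *ᵥ x) ⬝ᵥ (B *ᵥ y) = ((Bᵀ * B) *ᵥ x) ⬝ᵥ y := by
  rw [dotProduct_mulVec, ← mulVec_transpose, mulVec_mulVec]

open scoped MatrixOrder Matrix.Norms.L2Operator in
/-- Every nondegenerate ellipsoid is an affine image of the Euclidean unit ball. -/
lemma IsEllipsoid.exists_eq_image {n : ℕ} {E : Set (Phase n)} (hE : IsEllipsoid E) :
    ∃ (c : Phase n) (L : Matrix (Fin n ⊕ Fin n) (Fin n ⊕ Fin n) ℝ), IsUnit L ∧
      E = (fun z => c + L *ᵥ z) '' closedBall₂ n 1 := by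
  obtain ⟨c, M, hM, rfl⟩ := hE
  obtain ⟨B, hB, rfl⟩ := CStarAlgebra.isStrictlyPositive_iff_eq_star_mul_self.mp
    hM.isStrictlyPositive
  have hdet : IsUnit B.det := (Matrix.isUnit_iff_isUnit_det B).1 hB
  have hstar : star B = Bᵀ := by
    rw [star_eq_conjTranspose, conjTranspose_eq_transpose_of_trivial]
  refine ⟨c, B⁻¹, (Matrix.isUnit_nonsing_inv_iff).2 hB, ?_⟩
  ext z
  simp only [Set.mem_ofPred_eq, Set.mem_image, closedBall₂, hstar, ← mulVec_dotProduct_mulVec]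
  constructor
  · intro h
    refine ⟨B *ᵥ (z - c), by simpa using h, ?_⟩
    rw [mulVec_mulVec, Matrix.nonsing_inv_mul B hdet]
    simp
  · rintro ⟨w, hw, rfl⟩
    simp only [add_sub_cancel_left, mulVec_mulVec, Matrix.mul_nonsing_inv B hdet, one_mulVec]
    simpa using hw

lemma isEllipsoid_image {n : ℕ} (T : Phase n ≃ₗ[ℝ] Phase n) {E : Set (Phase n)}
    (hE : IsEllipsoid E) : IsEllipsoid (T '' E) := by
  obtain ⟨c, M, hM, rfl⟩ := hE
  have hN : ∀ z, LinearMap.toMatrix' (T.symm : Phase n →ₗ[ℝ] Phase n) *ᵥ z = T.symm z := fun z => by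
    simp [LinearMap.toMatrix'_mulVec]
  refine ⟨T c, (LinearMap.toMatrix' (T.symm : Phase n →ₗ[ℝ] Phase n))ᵀ * M *
    LinearMap.toMatrix' (T.symm : Phase n →ₗ[ℝ] Phase n), ?_, ?_⟩
  · rw [← conjTranspose_eq_transpose_of_trivial]
    refine hM.conjTranspose_mul_mul_same fun x y h => ?_
    simpa [hN] using h
  · ext z
    rw [LinearEquiv.image_eq_preimage_symm]
    simp only [Set.mem_ofPred_eq, Set.mem_preimage]
    rw [← mulVec_mulVec, ← mulVec_mulVec, hN, mulVec_transpose, ← dotProduct_mulVec, hN]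
    simp

/-- Lets the volume of the ball be cancelled, so that a volume comparison with `c + L(B)` becomes `1
≤ |det L|`. -/
lemma volume_closedBall₂_one (n : ℕ) :
    volume (closedBall₂ n 1) ≠ 0 ∧ volume (closedBall₂ n 1) ≠ ⊤ := by
  have hcont : Continuous fun z : Phase n => z ⬝ᵥ z := by
    simp only [dotProduct]; fun_prop
  constructor
  · have hopen : IsOpen {z : Phase n | z ⬝ᵥ z < 1} := isOpen_lt hcont continuous_const
    have hpos := hopen.measure_pos volume ⟨0, by simp⟩
    refine (hpos.trans_le (measure_mono fun z hz => ?_)).ne'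
    simpa [closedBall₂] using (le_of_lt hz)
  · have hsub : closedBall₂ n 1 ⊆ Metric.closedBall 0 1 := by
      intro z hz
      rw [mem_closedBall_zero_iff, pi_norm_le_iff_of_nonneg zero_le_one]
      intro i
      have h1 : z i * z i ≤ z ⬝ᵥ z :=
        Finset.single_le_sum (f := fun i => z i * z i) (fun j _ => mul_self_nonneg (z j))
          (Finset.mem_univ i)
      have h2 : z ⬝ᵥ z ≤ 1 := by simpa [closedBall₂] using hz
      rw [Real.norm_eq_abs, abs_le_one_iff_mul_self_le_one]
      linarith
    exact ((measure_mono hsub).trans_lt measure_closedBall_lt_top).ne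

lemma volume_affine_image {n : ℕ} (c : Phase n) (L : Matrix (Fin n ⊕ Fin n) (Fin n ⊕ Fin n) ℝ)
    (s : Set (Phase n)) :
    volume ((fun z => c + L *ᵥ z) '' s) = ENNReal.ofReal |L.det| * volume s := by
  have h : (fun z => c + L *ᵥ z) '' s = (fun z => c + z) '' (Matrix.toLin' L '' s) := by
    rw [Set.image_image]; simp
  rw [h, Set.image_add_left, measure_preimage_add, Measure.addHaar_image_linearMap,
    LinearMap.det_toLin']

/-- The Euclidean unit ball is the only ellipsoid inside the cube whose volume is at least that of
the ball. -/
lemma eq_closedBall₂_of_subset_cube {n : ℕ} {E : Set (Phase n)} (hE : IsEllipsoid E)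
    (hcube : ∀ z ∈ E, ∀ i, |z i| ≤ 1) (hvol : volume (closedBall₂ n 1) ≤ volume E) :
    E = closedBall₂ n 1 := by
  obtain ⟨c, L, hL, rfl⟩ := hE.exists_eq_image
  obtain ⟨hB0, hBtop⟩ := volume_closedBall₂_one n
  have hdet : 1 ≤ |L.det| := by
    rw [volume_affine_image] at hvol
    by_contra! hlt
    refine hvol.not_gt ?_
    calc ENNReal.ofReal |L.det| * volume (closedBall₂ n 1)
        < 1 * volume (closedBall₂ n 1) := by
          refine ENNReal.mul_lt_mul_left hB0 hBtop ?_
          rwa [ENNReal.ofReal_lt_one]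
      _ = _ := one_mul _
  have hW : (L * Lᵀ).PosDef := by
    rw [← conjTranspose_eq_transpose_of_trivial]
    refine PosDef.mul_conjTranspose_self L (vecMul_injective_of_isUnit hL)
  have hWdet : 1 ≤ (L * Lᵀ).det := by
    rw [det_mul, det_transpose, ← abs_mul_abs_self]
    nlinarith
  -- On the ellipsoid `c + L(B)` the `i`-th coordinate ranges over `c i ± r`, where `r` is the
  -- length of the `i`-th row of `L`. The extremes are attained at `± L i / r`.
  have hrow : ∀ i, |c i| + √((L * Lᵀ) i i) ≤ 1 := by
    intro i
    have hii : 0 < (L * Lᵀ) i i := hW.diag_pos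
    set r := √((L * Lᵀ) i i) with hr
    have hr0 : 0 < r := Real.sqrt_pos.2 hii
    have hrr : L i ⬝ᵥ L i = r * r := by
      rw [hr, Real.mul_self_sqrt hii.le]; rfl
    have key : ∀ t : ℝ, t * t = 1 → |c i + t * r| ≤ 1 := by
      intro t ht
      have hmem : (t / r) • L i ∈ closedBall₂ n 1 := by
        have : ((t / r) • L i) ⬝ᵥ ((t / r) • L i) = 1 := by
          rw [smul_dotProduct, dotProduct_smul, hrr]
          simp only [smul_eq_mul]
          field_simp
          linarith
        simp [closedBall₂, this]
      have h := hcube _ ⟨_, hmem, rfl⟩ i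
      have h2 : (L *ᵥ ((t / r) • L i)) i = t * r := by
        rw [mulVec_smul, Pi.smul_apply, mulVec, hrr, smul_eq_mul]
        field_simp
      simpa [h2] using h
    have h1 := abs_le.1 (key 1 (by norm_num))
    have h2 := abs_le.1 (key (-1) (by norm_num))
    rcases abs_cases (c i) with ⟨h, _⟩ | ⟨h, _⟩ <;> rw [h] <;> linarith [h1.1, h1.2, h2.1, h2.2]
  have hone : L * Lᵀ = 1 := by
    refine posDef_eq_one_of_diag_le_one hW (fun i => ?_) hWdet
    have := hrow i
    have h2 : √((L * Lᵀ) i i) ≤ 1 := by linarith [abs_nonneg (c i)]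
    simpa using (Real.sqrt_le_left zero_le_one).1 h2
  -- Once every row of `L` has length `1`, the cube leaves no room to move the center.
  have hc : c = 0 := by
    funext i
    have := hrow i
    rw [hone] at this
    simp only [one_apply_eq, Real.sqrt_one] at this
    exact abs_nonpos_iff.1 (by linarith)
  have hone' : Lᵀ * L = 1 := mul_eq_one_comm.1 hone
  ext z
  simp only [hc, zero_add, Set.mem_image, closedBall₂, Set.mem_ofPred_eq]
  constructor
  · rintro ⟨w, hw, rfl⟩
    rwa [mulVec_dotProduct_mulVec, hone', one_mulVec]
  · intro hz
    refine ⟨Lᵀ *ᵥ z, ?_, by rw [mulVec_mulVec, hone, one_mulVec]⟩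
    rwa [mulVec_dotProduct_mulVec, transpose_transpose, hone, one_mulVec]

lemma isEllipsoid_closedBall₂_one (n : ℕ) : IsEllipsoid (closedBall₂ n 1) :=
  ⟨0, 1, PosDef.one, by simp [closedBall₂]⟩

/-- The John ellipsoid of a set between the Euclidean unit ball and the cube is the unit ball. -/
lemma isJohnEllipsoid_iff_eq_closedBall₂ {n : ℕ} {K E : Set (Phase n)}
    (hball : closedBall₂ n 1 ⊆ K) (hcube : ∀ z ∈ K, ∀ i, |z i| ≤ 1) :
    IsJohnEllipsoid K E ↔ E = closedBall₂ n 1 := by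
  constructor
  · intro h
    exact eq_closedBall₂_of_subset_cube h.isEllipsoid (fun z hz => hcube z (h.subset hz))
      (h.volume_le _ (isEllipsoid_closedBall₂_one n) hball)
  · rintro rfl
    refine ⟨isEllipsoid_closedBall₂_one n, hball, fun E' hE' hsub => ?_⟩
    by_contra! hlt
    have := eq_closedBall₂_of_subset_cube hE' (fun z hz => hcube z (hsub hz)) hlt.le
    exact hlt.ne (by rw [this])

/-! ### Linear equivariance of John ellipsoids -/

/-- A competitor in `T '' K` pulls back to one in `K`, and `T` multiplies all volumes by the same
factor `|det T|`. -/
lemma IsJohnEllipsoid.image {n : ℕ} (T : Phase n ≃ₗ[ℝ] Phase n) {K E : Set (Phase n)}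
    (h : IsJohnEllipsoid K E) : IsJohnEllipsoid (T '' K) (T '' E) := by
  refine ⟨isEllipsoid_image T h.isEllipsoid, Set.image_mono h.subset, fun E' hE' hsub => ?_⟩
  have hE'' : T '' (T.symm '' E') = E' := by
    rw [Set.image_image]; simp
  have hle := h.volume_le (T.symm '' E') (isEllipsoid_image T.symm hE') (by
    rintro _ ⟨z, hz, rfl⟩
    obtain ⟨w, hw, rfl⟩ := hsub hz
    simpa using hw)
  rw [← hE'']
  have hT : ∀ s : Set (Phase n), volume (T '' s) =
      ENNReal.ofReal |LinearMap.det (T : Phase n →ₗ[ℝ] Phase n)| * volume s := fun s =>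
    Measure.addHaar_image_linearMap volume (T : Phase n →ₗ[ℝ] Phase n) s
  rw [hT, hT]
  gcongr

lemma isJohnEllipsoid_image_iff {n : ℕ} (T : Phase n ≃ₗ[ℝ] Phase n) {K E : Set (Phase n)} :
    IsJohnEllipsoid (T '' K) E ↔ IsJohnEllipsoid K (T.symm '' E) := by
  constructor
  · intro h
    simpa [Set.image_image] using h.image T.symm
  · intro h
    simpa [Set.image_image] using h.image T

/-! ### Normal form of the pairing matrix -/

/-- A matrix that expands lengths by at least `ħ` is brought to the identity by a pair of linear
changes of coordinates that shrink squared lengths by at least `ħ`. -/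
lemma exists_normalizing_pair {ι : Type*} [Fintype ι] [DecidableEq ι] {ħ : ℝ} (hħ : 0 < ħ)
    (G : Matrix ι ι ℝ) (hG : ∀ y, ħ ^ 2 * (y ⬝ᵥ y) ≤ (G *ᵥ y) ⬝ᵥ (G *ᵥ y)) :
    ∃ R₁ R₂ : Matrix ι ι ℝ, R₁ᵀ * G * R₂ = 1 ∧
      (∀ x, ħ * ((R₁ *ᵥ x) ⬝ᵥ (R₁ *ᵥ x)) ≤ x ⬝ᵥ x) ∧
      ∀ x, ħ * ((R₂ *ᵥ x) ⬝ᵥ (R₂ *ᵥ x)) ≤ x ⬝ᵥ x := by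
  have hH : (Gᵀ * G).IsHermitian := by
    simpa [conjTranspose_eq_transpose_of_trivial] using isHermitian_conjTranspose_mul_self G
  obtain ⟨U, ev, hU, hUG⟩ : ∃ (U : Matrix ι ι ℝ) (ev : ι → ℝ), Uᵀ * U = 1 ∧
      Uᵀ * (Gᵀ * G) * U = diagonal ev := by
    refine ⟨hH.eigenvectorUnitary, hH.eigenvalues, ?_, ?_⟩
    · have := Unitary.coe_star_mul_self hH.eigenvectorUnitary
      rwa [star_eq_conjTranspose, conjTranspose_eq_transpose_of_trivial] at this
    · have := hH.conjStarAlgAut_star_eigenvectorUnitary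
      rw [Unitary.conjStarAlgAut_star_apply] at this
      simpa [star_eq_conjTranspose, conjTranspose_eq_transpose_of_trivial] using this
  have hev : ∀ i, ħ ^ 2 ≤ ev i := by
    intro i
    have h := hG (U *ᵥ Pi.single i 1)
    have hGU : (G * U)ᵀ * (G * U) = diagonal ev := by
      rw [← hUG]; simp only [transpose_mul, Matrix.mul_assoc]
    rw [mulVec_mulVec, mulVec_dotProduct_mulVec, mulVec_dotProduct_mulVec, hU, hGU] at h
    simpa using h
  -- The singular values of `G` are `s i ^ 2`; `s i` is the share of each of the two factors.
  obtain ⟨s, hs0, hsħ, hs4⟩ : ∃ s : ι → ℝ, (∀ i, 0 < s i) ∧ (∀ i, ħ ≤ s i ^ 2) ∧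
      ∀ i, ev i = s i ^ 4 := by
    have hpos : ∀ i, 0 < ev i := fun i => (pow_pos hħ 2).trans_le (hev i)
    refine ⟨fun i => √(√(ev i)), fun i => by have := hpos i; positivity, fun i => ?_, fun i => ?_⟩
    · rw [Real.sq_sqrt (Real.sqrt_nonneg _)]
      exact Real.le_sqrt_of_sq_le (hev i)
    · rw [show 4 = 2 * 2 by norm_num, pow_mul, Real.sq_sqrt (Real.sqrt_nonneg _),
        Real.sq_sqrt (hpos i).le]
  have hcontr : ∀ R : Matrix ι ι ℝ, Rᵀ * R = diagonal (fun i => (s i ^ 2)⁻¹) →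
      ∀ x, ħ * ((R *ᵥ x) ⬝ᵥ (R *ᵥ x)) ≤ x ⬝ᵥ x := by
    intro R hR x
    rw [mulVec_dotProduct_mulVec, hR]
    simp only [dotProduct, mulVec_diagonal, Finset.mul_sum]
    refine Finset.sum_le_sum fun i _ => ?_
    have h : ħ * (s i ^ 2)⁻¹ ≤ 1 := by
      rw [← div_eq_mul_inv, div_le_one (by have := hs0 i; positivity)]
      exact hsħ i
    nlinarith [mul_self_nonneg (x i)]
  -- The columns of `G U diag(s⁻²)` are the left singular vectors, so both witnesses are an
  -- orthogonal matrix times `diag(s⁻¹)`.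
  refine ⟨G * U * diagonal (fun i => (s i ^ 3)⁻¹), U * diagonal (fun i => (s i)⁻¹), ?_,
    hcontr _ ?_, hcontr _ ?_⟩
  · calc _ = diagonal (fun i => (s i ^ 3)⁻¹) * (Uᵀ * (Gᵀ * G) * U) *
            diagonal (fun i => (s i)⁻¹) := by
          simp only [transpose_mul, diagonal_transpose, Matrix.mul_assoc]
      _ = 1 := by
          rw [hUG, diagonal_mul_diagonal, diagonal_mul_diagonal, ← diagonal_one]
          congr 1; funext i
          have := (hs0 i).ne'
          rw [hs4]; field_simp
  · calc _ = diagonal (fun i => (s i ^ 3)⁻¹) * (Uᵀ * (Gᵀ * G) * U) *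
            diagonal (fun i => (s i ^ 3)⁻¹) := by
          simp only [transpose_mul, diagonal_transpose, Matrix.mul_assoc]
      _ = _ := by
          rw [hUG, diagonal_mul_diagonal, diagonal_mul_diagonal]
          congr 1; funext i
          have := (hs0 i).ne'
          rw [hs4]; field_simp
  · calc _ = diagonal (fun i => (s i)⁻¹) * (Uᵀ * U) * diagonal (fun i => (s i)⁻¹) := by
          simp only [transpose_mul, diagonal_transpose, Matrix.mul_assoc]
      _ = _ := by
          rw [hU, Matrix.mul_one, diagonal_mul_diagonal]
          congr 1; funext i
          have := (hs0 i).ne'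
          field_simp

/-! ### Coordinates adapted to the Lagrangian frame -/

/-- A positive definite quadratic form on an `n`-dimensional real space is the standard one in
suitable coordinates. -/
lemma exists_linearEquiv_eq_dotProduct {V : Type*} [AddCommGroup V] [Module ℝ V]
    [FiniteDimensional ℝ V] {n : ℕ} (hn : Module.finrank ℝ V = n) (q : QuadraticForm ℝ V)
    (hq : q.PosDef) : ∃ e : (Fin n → ℝ) ≃ₗ[ℝ] V, ∀ x, q (e x) = x ⬝ᵥ x := by
  subst hn
  obtain ⟨w, hw, ⟨f⟩⟩ := q.equivalent_one_neg_one_weighted_sum_squared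
    (QuadraticMap.separatingLeft_of_anisotropic q hq.anisotropic)
  have hf : ∀ x, q (f.symm x) = ∑ i, w i * (x i * x i) := fun x => by
    rw [f.symm.map_app]
    simp [QuadraticMap.weightedSumSquares_apply]
  -- Sylvester's law leaves weights `±1`; a weight `-1` would give a nonzero vector of negative `q`.
  have hw1 : ∀ i, w i = 1 := by
    intro i
    refine (hw i).resolve_left fun h => ?_
    have h1 := hq (f.symm (Pi.single i 1)) (by
      intro h0
      have : (Pi.single i 1 : Fin (Module.finrank ℝ V) → ℝ) = 0 := by
        simpa using congrArg f h0
      simpa using congrFun this i)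
    rw [hf] at h1
    simp [Pi.single_apply, h] at h1
    linarith
  exact ⟨f.symm.toLinearEquiv, fun x => (hf x).trans (by simp [hw1, dotProduct])⟩

/-- `Matrix.J` is the transpose of `stdJ`, so moving the matrix to the second argument costs no
sign. -/
lemma sympForm_eq_dotProduct {n : ℕ} (z z' : Phase n) :
    sympForm z z' = z ⬝ᵥ (Matrix.J (Fin n) ℝ *ᵥ z') := by
  have h : stdJ n = (Matrix.J (Fin n) ℝ)ᵀ := by
    simp [stdJ, Matrix.J, fromBlocks_transpose]
  rw [sympForm, h, mulVec_transpose, ← dotProduct_mulVec]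

lemma dotProduct_eq_inl_add_inr {n : ℕ} (z w : Phase n) :
    z ⬝ᵥ w = (z ∘ Sum.inl) ⬝ᵥ (w ∘ Sum.inl) + (z ∘ Sum.inr) ⬝ᵥ (w ∘ Sum.inr) := by
  simp [dotProduct, Fintype.sum_sum_type]

/-- Coordinates on phase space in which `X` and `P` are the unit balls of the two factors. -/
lemma exists_frame_coordinates {n : ℕ} {ℓ ℓ' : Submodule ℝ (Phase n)}
    (hframe : IsLagrangianFrame ℓ ℓ') (e : (Fin n → ℝ) ≃ₗ[ℝ] ℓ) (e' : (Fin n → ℝ) ≃ₗ[ℝ] ℓ') :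
    ∃ T : Phase n ≃ₗ[ℝ] Phase n,
      ∀ z, T z = (e (z ∘ Sum.inl) : Phase n) + (e' (z ∘ Sum.inr) : Phase n) := by
  let f : Phase n →ₗ[ℝ] Phase n :=
    ℓ.subtype ∘ₗ e.toLinearMap ∘ₗ LinearMap.funLeft ℝ ℝ Sum.inl +
      ℓ'.subtype ∘ₗ e'.toLinearMap ∘ₗ LinearMap.funLeft ℝ ℝ Sum.inr
  have hf : ∀ z, f z = (e (z ∘ Sum.inl) : Phase n) + (e' (z ∘ Sum.inr) : Phase n) := fun z => rfl
  have hinj : Function.Injective f := by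
    rw [injective_iff_map_eq_zero]
    intro z hz
    rw [hf] at hz
    have hmem : (e (z ∘ Sum.inl) : Phase n) ∈ ℓ ⊓ ℓ' := by
      refine ⟨(e _).2, ?_⟩
      rw [eq_neg_of_add_eq_zero_left hz]
      exact ℓ'.neg_mem (e' _).2
    rw [hframe.transversal, Submodule.mem_bot] at hmem
    rw [hmem, zero_add] at hz
    have h1 : z ∘ Sum.inl = 0 := by simpa using hmem
    have h2 : z ∘ Sum.inr = 0 := by simpa using hz
    funext i
    rcases i with i | i
    · exact congrFun h1 i
    · exact congrFun h2 i
  exact ⟨LinearEquiv.ofInjectiveEndo f hinj, fun z => hf z⟩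

/-- A symplectic form in coordinates adapted to a Lagrangian frame is given by an off-diagonal
pairing matrix. -/
lemma exists_pairing_matrix {n : ℕ} {ℓ ℓ' : Submodule ℝ (Phase n)}
    (hframe : IsLagrangianFrame ℓ ℓ') (e : (Fin n → ℝ) ≃ₗ[ℝ] ℓ) (e' : (Fin n → ℝ) ≃ₗ[ℝ] ℓ')
    (T : Matrix (Fin n ⊕ Fin n) (Fin n ⊕ Fin n) ℝ)
    (hT : ∀ z : Phase n,
      T *ᵥ z = (e (z ∘ Sum.inl) : Phase n) + (e' (z ∘ Sum.inr) : Phase n)) :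
    ∃ G : Matrix (Fin n) (Fin n) ℝ, Tᵀ * Matrix.J (Fin n) ℝ * T = fromBlocks 0 G (-Gᵀ) 0 ∧
      ∀ x y, sympForm (e x : Phase n) (e' y : Phase n) = x ⬝ᵥ (G *ᵥ y) := by
  set Q := Tᵀ * Matrix.J (Fin n) ℝ * T with hQ
  have hform : ∀ u v : Phase n, sympForm (T *ᵥ u) (T *ᵥ v) = u ⬝ᵥ (Q *ᵥ v) := fun u v => by
    rw [sympForm_eq_dotProduct, hQ, ← mulVec_mulVec, ← mulVec_mulVec, dotProduct_mulVec u,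
      ← mulVec_transpose, transpose_transpose]
  have hskew : Qᵀ = -Q := by
    simp [hQ, transpose_mul, Matrix.mul_assoc]
  have hl : ∀ x, T *ᵥ (Sum.elim x 0 : Phase n) = (e x : Phase n) := fun x => by
    rw [hT]; simp
  have hr : ∀ y, T *ᵥ (Sum.elim 0 y : Phase n) = (e' y : Phase n) := fun y => by
    rw [hT]; simp
  have hentry : ∀ i j, Q i j = sympForm (T *ᵥ Pi.single i 1) (T *ᵥ Pi.single j 1) := fun i j => by
    rw [hform]; simp
  have hsl : ∀ i : Fin n, (Pi.single (Sum.inl i) 1 : Phase n) = Sum.elim (Pi.single i (1 : ℝ)) (0 : Fin n → ℝ) :=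
    fun i => by ext (j | j) <;> simp [Pi.single_apply]
  have hsr : ∀ i : Fin n, (Pi.single (Sum.inr i) 1 : Phase n) = Sum.elim (0 : Fin n → ℝ) (Pi.single i (1 : ℝ)) :=
    fun i => by ext (j | j) <;> simp [Pi.single_apply]
  -- Isotropy of `ℓ` and `ℓ'` kills the diagonal blocks; skewness ties the other two together.
  have hblocks : Q = fromBlocks 0 Q.toBlocks₁₂ (-Q.toBlocks₁₂ᵀ) 0 := by
    ext (i | i) (j | j)
    · rw [hentry, hsl, hsl, hl, hl]
      simpa using hframe.left.isotropic _ (e _).2 _ (e _).2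
    · simp [toBlocks₁₂]
    · have := congrFun (congrFun hskew (Sum.inr i)) (Sum.inl j)
      simp only [transpose_apply, Matrix.neg_apply] at this
      simp [toBlocks₁₂, this]
    · rw [hentry, hsr, hsr, hr, hr]
      simpa using hframe.right.isotropic _ (e' _).2 _ (e' _).2
  refine ⟨Q.toBlocks₁₂, hblocks, fun x y => ?_⟩
  rw [← hl, ← hr, hform]
  conv_lhs => rw [hblocks]
  simp [fromBlocks_mulVec, sumElim_dotProduct_sumElim]

/-- The polar dual inclusion says that the pairing matrix expands lengths by at least `ħ`. -/
lemma le_of_unit_ball_polar {ι : Type*} [Fintype ι] {ħ : ℝ} (hħ : 0 < ħ)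
    (G : Matrix ι ι ℝ)
    (hG : ∀ y, (∀ x, x ⬝ᵥ x ≤ 1 → x ⬝ᵥ (G *ᵥ y) ≤ ħ) → y ⬝ᵥ y ≤ 1) (y : ι → ℝ) :
    ħ ^ 2 * (y ⬝ᵥ y) ≤ (G *ᵥ y) ⬝ᵥ (G *ᵥ y) := by
  by_contra! hlt
  set a := (G *ᵥ y) ⬝ᵥ (G *ᵥ y) with ha
  set b := y ⬝ᵥ y with hb
  have ha0 : 0 ≤ a := dotProduct_self_star_nonneg (G *ᵥ y)
  have hab : 0 < a + ħ ^ 2 * b := by linarith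
  -- As `a < ħ² b`, this choice gives both `t² a ≤ ħ²` and `t² b > 1`: `t • y` is in the polar dual
  -- of the ball but outside the unit ball. The formula avoids dividing by `a`, which may be zero.
  set t := √(2 * ħ ^ 2 / (a + ħ ^ 2 * b)) with ht
  have htt : t * t = 2 * ħ ^ 2 / (a + ħ ^ 2 * b) := Real.mul_self_sqrt (by positivity)
  have h := hG (t • y) fun x hx => by
    have hcs : (x ⬝ᵥ (G *ᵥ y)) ^ 2 ≤ (x ⬝ᵥ x) * a := by
      have := Finset.sum_mul_sq_le_sq_mul_sq Finset.univ x (G *ᵥ y)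
      simpa [dotProduct, ha, sq] using this
    rw [mulVec_smul, dotProduct_smul, smul_eq_mul]
    refine abs_le_of_sq_le_sq' ?_ hħ.le |>.2
    calc (t * (x ⬝ᵥ (G *ᵥ y))) ^ 2 = t * t * (x ⬝ᵥ (G *ᵥ y)) ^ 2 := by ring
      _ ≤ t * t * a := by
          refine mul_le_mul_of_nonneg_left (hcs.trans ?_) (mul_self_nonneg t)
          exact mul_le_of_le_one_left ha0 hx
      _ ≤ ħ ^ 2 := by
          rw [htt, div_mul_eq_mul_div, div_le_iff₀ hab]
          nlinarith [sq_nonneg ħ]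
  rw [smul_dotProduct, dotProduct_smul, smul_eq_mul, smul_eq_mul, ← mul_assoc, htt,
    div_mul_eq_mul_div, div_le_one hab] at h
  linarith

end GeomQuantum

/-! ### The John ellipsoid of a geometric mixed state -/

open GeomQuantum Matrix in
theorem mainTheorem12 (n : ℕ) (ħ : ℝ) (hħ : 0 < ħ)
    (ℓ ℓ' : Submodule ℝ (GeomQuantum.Phase n)) (X P : Set (GeomQuantum.Phase n))
    (hXP : GeomQuantum.IsGeometricMixedState ħ ℓ ℓ' X P) :
    (∃! Ω : Set (GeomQuantum.Phase n),
      GeomQuantum.IsJohnEllipsoid (GeomQuantum.frameProduct X P) Ω) ∧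
    ∀ Ω : Set (GeomQuantum.Phase n),
      GeomQuantum.IsJohnEllipsoid (GeomQuantum.frameProduct X P) Ω →
        GeomQuantum.IsQuantumAdmissible ħ Ω := by
  obtain ⟨q, hq, hX⟩ := hXP.ellipsoid_left
  obtain ⟨q', hq', hP⟩ := hXP.ellipsoid_right
  obtain ⟨e, he⟩ := exists_linearEquiv_eq_dotProduct hXP.frame.left.finrank_eq q hq
  obtain ⟨e', he'⟩ := exists_linearEquiv_eq_dotProduct hXP.frame.right.finrank_eq q' hq'
  obtain ⟨T, hT⟩ := exists_frame_coordinates hXP.frame e e'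
  have hXmem : ∀ z, z ∈ X ↔ ∃ x, x ⬝ᵥ x ≤ 1 ∧ (e x : Phase n) = z := fun z => by
    rw [hX]
    constructor
    · rintro ⟨w, hw, rfl⟩
      refine ⟨e.symm w, ?_, by simp⟩
      rw [← he]; simpa using hw
    · rintro ⟨x, hx, rfl⟩
      exact ⟨e x, by simpa [he] using hx, rfl⟩
  have hPmem : ∀ z, z ∈ P ↔ ∃ y, y ⬝ᵥ y ≤ 1 ∧ (e' y : Phase n) = z := fun z => by
    rw [hP]
    constructor
    · rintro ⟨w, hw, rfl⟩
      refine ⟨e'.symm w, ?_, by simp⟩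
      rw [← he']; simpa using hw
    · rintro ⟨x, hx, rfl⟩
      exact ⟨e' x, by simpa [he'] using hx, rfl⟩
  have hK : frameProduct X P = T '' {z : Phase n |
      (z ∘ Sum.inl) ⬝ᵥ (z ∘ Sum.inl) ≤ 1 ∧ (z ∘ Sum.inr) ⬝ᵥ (z ∘ Sum.inr) ≤ 1} := by
    ext z
    simp only [frameProduct, Set.mem_add, hXmem, hPmem, Set.mem_image, Set.mem_ofPred_eq]
    constructor
    · rintro ⟨_, ⟨x, hx, rfl⟩, _, ⟨y, hy, rfl⟩, rfl⟩
      exact ⟨Sum.elim x y, by simpa using ⟨hx, hy⟩, by rw [hT]; simp⟩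
    · rintro ⟨w, ⟨h1, h2⟩, rfl⟩
      exact ⟨_, ⟨_, h1, rfl⟩, _, ⟨_, h2, rfl⟩, (hT w).symm⟩
  have hJohn : ∀ Ω, IsJohnEllipsoid (frameProduct X P) Ω ↔ Ω = T '' closedBall₂ n 1 := by
    intro Ω
    rw [hK, isJohnEllipsoid_image_iff, isJohnEllipsoid_iff_eq_closedBall₂]
    · constructor
      · intro h; rw [← h, Set.image_image]; simp
      · rintro rfl; rw [Set.image_image]; simp
    · intro z hz
      simp only [closedBall₂, Set.mem_ofPred_eq, dotProduct_eq_inl_add_inr] at hz ⊢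
      have h1 := dotProduct_self_star_nonneg (z ∘ Sum.inl)
      have h2 := dotProduct_self_star_nonneg (z ∘ Sum.inr)
      simp only [star_trivial] at h1 h2
      constructor <;> linarith
    · rintro z ⟨h1, h2⟩ i
      rw [abs_le_one_iff_mul_self_le_one]
      rcases i with i | i
      · exact (Finset.single_le_sum (f := fun i => (z ∘ Sum.inl) i * (z ∘ Sum.inl) i)
          (fun j _ => mul_self_nonneg _) (Finset.mem_univ i)).trans h1
      · exact (Finset.single_le_sum (f := fun i => (z ∘ Sum.inr) i * (z ∘ Sum.inr) i)
          (fun j _ => mul_self_nonneg _) (Finset.mem_univ i)).trans h2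
  refine ⟨⟨_, (hJohn _).2 rfl, fun Ω hΩ => (hJohn Ω).1 hΩ⟩, fun Ω hΩ => ?_⟩
  obtain rfl := (hJohn Ω).1 hΩ
  constructor
  · set N := LinearMap.toMatrix' (T.symm : Phase n →ₗ[ℝ] Phase n)
    have hN : ∀ z, N *ᵥ z = T.symm z := fun z => by simp [N, LinearMap.toMatrix'_mulVec]
    refine ⟨ħ • (Nᵀ * N), ?_, ?_⟩
    · rw [← conjTranspose_eq_transpose_of_trivial]
      exact (PosDef.conjTranspose_mul_self N fun x y h => by simpa [hN] using h).smul hħ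
    · ext z
      rw [LinearEquiv.image_eq_preimage_symm]
      simp only [closedBall₂, Set.mem_preimage, Set.mem_ofPred_eq, smul_mulVec, smul_dotProduct,
        ← mulVec_dotProduct_mulVec, hN, smul_eq_mul, one_pow]
      exact (mul_le_iff_le_one_right hħ).symm
  · set A := LinearMap.toMatrix' (T : Phase n →ₗ[ℝ] Phase n)
    have hA : ∀ z, A *ᵥ z = T z := fun z => by simp [A, LinearMap.toMatrix'_mulVec]
    obtain ⟨G, hG, hpair⟩ := exists_pairing_matrix hXP.frame e e' A fun z => by rw [hA, hT]
    have hexp := le_of_unit_ball_polar hħ G fun y hy => by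
      obtain ⟨y', hy', h⟩ := (hPmem (e' y)).1 (hXP.polarDual_subset ⟨(e' y).2, fun z hz => by
        obtain ⟨x, hx, rfl⟩ := (hXmem z).1 hz
        rw [hpair]
        exact hy x hx⟩)
      rwa [e'.injective (Subtype.ext h)] at hy'
    obtain ⟨R₁, R₂, hR, hR₁, hR₂⟩ := exists_normalizing_pair hħ G hexp
    have hR' : R₂ᵀ * Gᵀ * R₁ = 1 := by
      simpa [transpose_mul, Matrix.mul_assoc] using congrArg transpose hR
    -- The sign makes the upper right block `-R₁ᵀ G R₂ = -1`, matching `Matrix.J = (0 -I; I 0)`.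
    refine ⟨A * fromBlocks (-R₁) 0 0 R₂, ?_, ?_⟩
    · rw [SymplecticGroup.mem_iff']
      calc _ = (fromBlocks (-R₁) 0 0 R₂)ᵀ * (Aᵀ * Matrix.J (Fin n) ℝ * A) *
              fromBlocks (-R₁) 0 0 R₂ := by
            simp only [transpose_mul, Matrix.mul_assoc]
        _ = _ := by
            rw [hG, fromBlocks_transpose, fromBlocks_multiply, fromBlocks_multiply, Matrix.J]
            simp [hR, hR']
    · rintro _ ⟨z, hz, rfl⟩
      refine ⟨fromBlocks (-R₁) 0 0 R₂ *ᵥ z, ?_, by simp only [← mulVec_mulVec, hA]⟩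
      simp only [closedBall₂, Set.mem_ofPred_eq, Real.sq_sqrt hħ.le] at hz ⊢
      rw [fromBlocks_mulVec, sumElim_dotProduct_sumElim]
      rw [dotProduct_eq_inl_add_inr] at hz
      simp only [neg_mulVec, zero_mulVec, add_zero, zero_add, neg_dotProduct_neg, one_pow]
      have h1 := hR₁ (z ∘ Sum.inl)
      have h2 := hR₂ (z ∘ Sum.inr)
      nlinarith
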